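/- For $a,b\ge 0$ let $M_{a,b}$ be the space of complex $a\times b$ matrices with the operator norm $\|\cdot\|$ (with respect to Euclidean norms), and $M_n=M_{n,n}$. For a linear map $\phi:M_n\to M_k$ put $$\|\phi\|_{cb}=\sup_{m\ge1}\|\mathrm{id}_m\otimes\phi\|,\qquad \|\phi\|_\diamond=\|\mathrm{id}_n\otimes\phi\|_1,$$ where $\|\Psi\|=\sup_{\|X\|\le1}\|\Psi(X)\|$ and $\|\Psi\|_1=\sup_{\|X\|_1\le1}\|\Psi(X)\|_1$, $\|X\|_1=\mathrm{Tr}\,(X^\dagger X)^{1/2}$. Let $\phi^\dagger:M_k\to M_n$ be the dual map, $\mathrm{Tr}(\phi(X)Y)=\mathrm{Tr}(X\phi^\dagger(Y))$. For $U\in M_{k,n}\otimes M_{n,k}$ let $$\|U\|_h=\inf\Big\{\Big\|\sum_iA_iA_i^\dagger\Big\|^{1/2}\Big\|\sum_iB_i^\dagger B_i\Big\|^{1/2}\Big\},$$ the infimum being over all finite representations $U=\sum_iA_i\otimes B_i$ with $A_i\in M_{k,n}$, $B_i\in M_{n,k}$. Write $M_{k,n}\otimes_hM_{n,k}$ for the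 tensor product with $\|\cdot\|_h$, and $CB(M_n,M_k)$ for the space of all linear maps $M_n\to M_k$ with $\|\cdot\|_{cb}$. **Theorem (Haagerup).** Let $n,k\ge 0$ be integers. Then $\|\phi\|_{cb}<\infty$ for every linear $\phi:M_n\to M_k$, $\|\cdot\|_{cb}$ and $\|\cdot\|_h$ are norms, and the linear map $\Gamma:M_{k,n}\otimes_hM_{n,k}\to CB(M_n,M_k)$ given by $\Gamma(A\otimes B)(X)=AXB$ is an isometric isomorphism: it is bijective and $\|\Gamma(U)\|_{cb}=\|U\|_h$ for all $U$. Moreover, for every linear map $\phi:M_n\to M_k$, $$\|\phi\|_{cb}=\|\phi^\dagger\|_\diamond=\inf\Big\{\Big\|\sum_iA_iA_i^\dagger\Big\|^{1/2}\Big\|\sum_iB_i^\dagger B_i\Big\|^{1/2}\Big\},$$ where the infimum is taken over all generalized Choi–Kraus representations of $\phi$, that is, all finite families $A_i\in M_{k,n}$, $B_i\in M_{n,k}$ with $\phi(X)=\sum_iA_iXB_i$ for all $X\in M_n$ (and such families exist). -/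

import Mathlib

open scoped TensorProduct Matrix Kronecker Matrix.Norms.L2Operator

noncomputable section

namespace CBHaagerup

/-- The `a × b` complex matrices `M_{a,b}`; the norm is the operator norm between the Euclidean
spaces `ℂ^b` and `ℂ^a`. -/
abbrev Mat (a b : ℕ) : Type := Matrix (Fin a) (Fin b) ℂ

/-- `N` is a norm on the complex vector space `V`. -/
def IsNorm {V : Type*} [AddCommGroup V] [Module ℂ V] (N : V → ℝ) : Prop :=
  @NormedSpace.Core ℂ V _ _ _ ⟨N⟩

/-- The amplification `id_m ⊗ φ : M_m(M_n) → M_m(M_k)`, `(X_{ij}) ↦ (φ(X_{ij}))`, where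
`M_m(M_n) = M_m ⊗ M_n` is identified with the matrices indexed by pairs. -/
def ampl {n k : ℕ} (m : ℕ) (φ : Mat n n →ₗ[ℂ] Mat k k) :
    Matrix (Fin m × Fin n) (Fin m × Fin n) ℂ →ₗ[ℂ] Matrix (Fin m × Fin k) (Fin m × Fin k) ℂ :=
  (Matrix.compLinearEquiv (Fin m) (Fin m) (Fin k) (Fin k) ℂ ℂ).toLinearMap ∘ₗ
    φ.mapMatrix ∘ₗ
      (Matrix.compLinearEquiv (Fin m) (Fin m) (Fin n) (Fin n) ℂ ℂ).symm.toLinearMap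

theorem ampl_apply {n k : ℕ} (m : ℕ) (φ : Mat n n →ₗ[ℂ] Mat k k)
    (X : Matrix (Fin m × Fin n) (Fin m × Fin n) ℂ) (i j : Fin m) (a b : Fin k) :
    ampl m φ X (i, a) (j, b) = φ (Matrix.of fun c d => X (i, c) (j, d)) a b :=
  rfl

theorem ampl_kronecker {n k : ℕ} (m : ℕ) (φ : Mat n n →ₗ[ℂ] Mat k k) (C : Mat m m)
    (X : Mat n n) : ampl m φ (C ⊗ₖ X) = C ⊗ₖ φ X := by
  ext ⟨i, a⟩ ⟨j, b⟩
  have h : (Matrix.of fun c d => (C ⊗ₖ X) (i, c) (j, d)) = C i j • X := by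
    ext c d
    simp
  rw [ampl_apply, h, map_smul]
  simp

/-- The norm `‖Ψ‖ = sup {‖Ψ X‖ : ‖X‖ ≤ 1}` of a linear map between matrix algebras, with respect
to the operator norms of matrices. -/
def opNorm {ι κ : Type} [Fintype ι] [DecidableEq ι] [Fintype κ] [DecidableEq κ]
    (Ψ : Matrix ι ι ℂ →ₗ[ℂ] Matrix κ κ ℂ) : ℝ :=
  ‖LinearMap.toContinuousLinearMap Ψ‖

/-- The completely bounded norm `‖φ‖_cb = sup_{m ≥ 1} ‖id_m ⊗ φ‖`. -/
def cbNorm {n k : ℕ} (φ : Mat n n →ₗ[ℂ] Mat k k) : ℝ :=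
  ⨆ m : ℕ, opNorm (ampl (m + 1) φ)

open scoped MatrixOrder in
/-- The trace norm `‖X‖₁ = Tr |X|`, with `|X| = (X† X)^{1/2}`. -/
def traceNorm {ι : Type} [Fintype ι] [DecidableEq ι] (X : Matrix ι ι ℂ) : ℝ :=
  (Matrix.trace (CFC.sqrt (Xᴴ * X))).re

/-- The norm `‖Ψ‖₁ = sup {‖Ψ X‖₁ : ‖X‖₁ ≤ 1}` of a linear map between matrix algebras. -/
def oneNorm {ι κ : Type} [Fintype ι] [DecidableEq ι] [Fintype κ] [DecidableEq κ]
    (Ψ : Matrix ι ι ℂ →ₗ[ℂ] Matrix κ κ ℂ) : ℝ :=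
  sSup {r : ℝ | ∃ X : Matrix ι ι ℂ, traceNorm X ≤ 1 ∧ r = traceNorm (Ψ X)}

/-- The diamond norm `‖φ‖_◇ = ‖id_n ⊗ φ‖₁` of `φ : M_n → M_k`. -/
def diamondNorm {n k : ℕ} (φ : Mat n n →ₗ[ℂ] Mat k k) : ℝ :=
  oneNorm (ampl n φ)

/-- The dual map `φ† : M_k → M_n`, determined by `Tr(φ(X) Y) = Tr(X φ†(Y))`
(see `trace_mul_dualMap`). -/
def dualMap {n k : ℕ} (φ : Mat n n →ₗ[ℂ] Mat k k) : Mat k k →ₗ[ℂ] Mat n n where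
  toFun Y := Matrix.of fun i j => Matrix.trace (φ (Matrix.single j i 1) * Y)
  map_add' Y Z := by ext i j; simp [Matrix.mul_add]
  map_smul' c Y := by ext i j; simp

theorem trace_mul_dualMap {n k : ℕ} (φ : Mat n n →ₗ[ℂ] Mat k k) (X : Mat n n) (Y : Mat k k) :
    Matrix.trace (φ X * Y) = Matrix.trace (X * dualMap φ Y) := by
  have h : φ X = ∑ i, ∑ j, X i j • φ (Matrix.single i j 1) := by
    conv_lhs => rw [Matrix.matrix_eq_sum_single X]
    simp only [map_sum, ← map_smul, Matrix.smul_single, smul_eq_mul, mul_one]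
  rw [h]
  simp only [Matrix.sum_mul, Matrix.trace_sum, Matrix.smul_mul, Matrix.trace_smul]
  simp [Matrix.trace, Matrix.mul_apply, dualMap]

/-- The linear map `Γ : M_{k,n} ⊗ M_{n,k} → L(M_n, M_k)` with `Γ(A ⊗ B)(X) = A X B`. -/
def Gam (n k : ℕ) : Mat k n ⊗[ℂ] Mat n k →ₗ[ℂ] (Mat n n →ₗ[ℂ] Mat k k) :=
  TensorProduct.lift <|
    LinearMap.mk₂ ℂ
      (fun (A : Mat k n) (B : Mat n k) =>
        ({ toFun := fun X => A * X * B
           map_add' := fun X Y => by rw [Matrix.mul_add, Matrix.add_mul]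
           map_smul' := fun c X => by simp } : Mat n n →ₗ[ℂ] Mat k k))
      (fun A A' B => by ext1 X; simp [Matrix.add_mul])
      (fun c A B => by ext1 X; simp)
      (fun A B B' => by ext1 X; simp [Matrix.mul_add])
      (fun c A B => by ext1 X; simp)

/-- The quantity `‖∑ A_i A_i†‖^{1/2} ‖∑ B_i† B_i‖^{1/2}`. -/
def krausCost {n k m : ℕ} (A : Fin m → Mat k n) (B : Fin m → Mat n k) : ℝ :=
  √‖∑ i, A i * (A i)ᴴ‖ * √‖∑ i, (B i)ᴴ * B i‖

/-- The Haagerup tensor norm on `M_{k,n} ⊗ M_{n,k}`. -/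
def haagerupNorm {n k : ℕ} (U : Mat k n ⊗[ℂ] Mat n k) : ℝ :=
  sInf {r : ℝ | ∃ (m : ℕ) (A : Fin m → Mat k n) (B : Fin m → Mat n k),
    U = ∑ i, A i ⊗ₜ[ℂ] B i ∧ r = krausCost A B}

/-- `φ(X) = ∑ A_i X B_i` for all `X`: a generalized Choi-Kraus representation of `φ`. -/
def IsChoiKraus {n k m : ℕ} (φ : Mat n n →ₗ[ℂ] Mat k k) (A : Fin m → Mat k n)
    (B : Fin m → Mat n k) : Prop :=
  ∀ X : Mat n n, φ X = ∑ i, A i * X * B i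

end CBHaagerup

end

namespace CBHaagerup

/-! ### Polar decomposition and trace-norm duality -/

section TraceDuality

open scoped MatrixOrder ComplexOrder

variable {ι κ : Type} [Fintype ι] [Fintype κ]

/-! Everything reduces to the single number `d = opNorm (ampl k φ)`. A representation `φ(X) = ∑ A_i
X B_i` writes each amplification as (row of `1 ⊗ A_i`) · (copies of `X`) · (column of `1 ⊗ B_i`), so
its cost bounds all of them (`opNorm_ampl_le_krausCost`).

Conversely, for every `c > d` some representation has both norms below `c`
(`exists_isChoiKraus_norm_lt`). The pairs dominating `(∑ A_i A_i†, ∑ B_i† B_i)` form a convex,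
upward closed set. If it missed the ball of radius `c`, Hahn–Banach would give a separating
functional, necessarily `Tr(ρ·) + Tr(σ·)` with `ρ, σ ≥ 0`. This is excluded by a representation of
weighted cost at most `d (Tr ρ + Tr σ)` (`exists_weighted_representation`): with `ρ = R†R` and `σ =
SS†`, reshape `RφS` into a matrix and factor it optimally for the nuclear norm. The dual certificate
for that norm is a contraction `Y`, and pairing it with `RφS` is a matrix coefficient of `ampl k φ
Y` at the vectorizations of `R` and `S`. These have length `k²`, which is why the `k`-th
amplification suffices.

Hence `d` is both the cb norm and the infimum of costs. Trace duality identifies it with the diamond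
norm of the dual map, and the statements on `Γ` follow by a dimension count and transport. -/

theorem re_trace_conjTranspose_mul_self (T : Matrix ι κ ℂ) :
    (Tᴴ * T).trace.re = ∑ i, ∑ j, ‖T i j‖ ^ 2 := by
  rw [Finset.sum_comm]
  simp [Matrix.trace, Matrix.mul_apply, ← Complex.normSq_eq_norm_sq, Complex.normSq_apply]

variable [DecidableEq κ]

theorem norm_dotProduct_mulVec_le (Z : Matrix ι κ ℂ) (x : ι → ℂ) (y : κ → ℂ) :
    ‖x ⬝ᵥ Z *ᵥ y‖ ≤ ‖Z‖ * (√(∑ i, ‖x i‖ ^ 2) * √(∑ i, ‖y i‖ ^ 2)) := by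
  have h1 := Matrix.l2_opNorm_mulVec Z (WithLp.toLp 2 y)
  have h2 := norm_inner_le_norm (𝕜 := ℂ) (WithLp.toLp 2 (star x))
    ((EuclideanSpace.equiv ι ℂ).symm <| Z *ᵥ y)
  have h3 : inner ℂ (WithLp.toLp 2 (star x)) ((EuclideanSpace.equiv ι ℂ).symm <| Z *ᵥ y) =
      x ⬝ᵥ Z *ᵥ y := by
    simp [PiLp.inner_apply, dotProduct, mul_comm]
  rw [h3] at h2
  refine h2.trans ?_
  have h4 : ‖WithLp.toLp 2 (star x)‖ = √(∑ i, ‖x i‖ ^ 2) := by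
    simp [EuclideanSpace.norm_eq]
  have h5 : ‖WithLp.toLp 2 y‖ = √(∑ i, ‖y i‖ ^ 2) := by
    simp [EuclideanSpace.norm_eq]
  rw [h5] at h1
  rw [h4]
  calc _ ≤ √(∑ i, ‖x i‖ ^ 2) * (‖Z‖ * √(∑ i, ‖y i‖ ^ 2)) := by gcongr
    _ = _ := by ring

theorem norm_le_of_dotProduct_mulVec_le (Z : Matrix ι κ ℂ) {c : ℝ} (hc : 0 ≤ c)
    (h : ∀ (x : ι → ℂ) (y : κ → ℂ),
      ‖x ⬝ᵥ Z *ᵥ y‖ ≤ c * (√(∑ i, ‖x i‖ ^ 2) * √(∑ i, ‖y i‖ ^ 2))) : ‖Z‖ ≤ c := by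
  rw [Matrix.l2_opNorm_def]
  refine ContinuousLinearMap.opNorm_le_bound _ hc fun y => ?_
  set w : EuclideanSpace ℂ ι := (((Matrix.toEuclideanLin (𝕜 := ℂ) (m := ι) (n := κ)).trans
    LinearMap.toContinuousLinearMap) Z) y with hw
  have hw' : ∀ i, w i = (Z *ᵥ y) i := fun i => rfl
  have h1 := h (star w.ofLp) y.ofLp
  -- Testing against the conjugate of `w = Zy` turns the bilinear pairing into `‖w‖²`.
  have h2 : star w.ofLp ⬝ᵥ Z *ᵥ y.ofLp = ((‖w‖ ^ 2 : ℝ) : ℂ) := by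
    have : inner ℂ w w = ((‖w‖ ^ 2 : ℝ) : ℂ) := by
      rw [inner_self_eq_norm_sq_to_K]; norm_cast
    rw [← this]
    simp only [PiLp.inner_apply, dotProduct, Pi.star_apply, ← hw', RCLike.inner_apply]
    exact Finset.sum_congr rfl fun i _ => by rw [mul_comm]; rfl
  have h3 : √(∑ i, ‖star w.ofLp i‖ ^ 2) = ‖w‖ := by simp [EuclideanSpace.norm_eq]
  have h4 : √(∑ i, ‖y.ofLp i‖ ^ 2) = ‖y‖ := by simp [EuclideanSpace.norm_eq]
  rw [h2, h3, h4, Complex.norm_real, Real.norm_of_nonneg (by positivity)] at h1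
  rcases eq_or_lt_of_le (norm_nonneg w) with h0 | h0
  · rw [← h0]; positivity
  · refine le_of_mul_le_mul_left ?_ h0
    nlinarith

variable [DecidableEq ι]

noncomputable instance instCStarAlgebraMatrix : CStarAlgebra (Matrix ι ι ℂ) where

/-- `|Tr (Z S)| ≤ ‖Z‖ Tr S` for positive semidefinite `S`. -/
theorem norm_trace_mul_le (Z : Matrix ι ι ℂ) {S : Matrix ι ι ℂ} (hS : S.PosSemidef) :
    ‖(Z * S).trace‖ ≤ ‖Z‖ * S.trace.re := by
  obtain ⟨T, rfl⟩ := CStarAlgebra.nonneg_iff_eq_star_mul_self.mp hS.nonneg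
  rw [Matrix.star_eq_conjTranspose, ← mul_assoc, Matrix.trace_mul_comm,
    re_trace_conjTranspose_mul_self]
  have h : (T * (Z * Tᴴ)).trace = ∑ i, T i ⬝ᵥ Z *ᵥ star (T i) := by
    simp [Matrix.trace, Matrix.mul_apply, dotProduct, Matrix.mulVec]
  rw [h, Finset.mul_sum]
  refine (norm_sum_le _ _).trans (Finset.sum_le_sum fun i _ => ?_)
  refine (norm_dotProduct_mulVec_le _ _ _).trans_eq ?_
  simp only [Pi.star_apply, norm_star]
  rw [Real.mul_self_sqrt (by positivity)]

/-- Polar decomposition of a square matrix. -/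
theorem exists_polar (M : Matrix ι ι ℂ) : ∃ W : Matrix ι ι ℂ, ‖W‖ ≤ 1 ∧
    M = W * CFC.sqrt (Mᴴ * M) ∧ Wᴴ * M = CFC.sqrt (Mᴴ * M) := by
  set S := CFC.sqrt (Mᴴ * M) with hS
  have hSS : S * S = Mᴴ * M :=
    CFC.sqrt_mul_sqrt_self _ (Matrix.posSemidef_conjTranspose_mul_self M).nonneg
  have hSa : IsSelfAdjoint S := (CFC.sqrt_nonneg _).isSelfAdjoint
  have hcont : ∀ f : ℝ → ℝ, ContinuousOn f (spectrum ℝ S) := fun f =>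
    (Matrix.finite_real_spectrum (A := S)).continuousOn f
  -- Since `0⁻¹ = 0`, this is the pseudo-inverse of `S`, and `M * I` is the partial isometry of the
  -- polar decomposition.
  set I := cfc (fun x : ℝ => x⁻¹) S with hI
  have hIa : star I = I := (cfc_predicate (fun x : ℝ => x⁻¹) S).star_eq
  have hid : cfc (fun x : ℝ => x) S = S := cfc_id' ℝ S
  have hISS : I * (S * S) = S := by
    suffices I * (cfc (fun x : ℝ => x) S * cfc (fun x : ℝ => x) S) = cfc (fun x : ℝ => x) S by
      rwa [hid] at this
    rw [hI, ← cfc_mul _ _ S (hcont _) (hcont _), ← cfc_mul _ _ S (hcont _) (hcont _)]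
    exact cfc_congr fun x _ => by by_cases h : x = 0 <;> simp [h]
  have hSIS : S * I * S = S := by
    suffices cfc (fun x : ℝ => x) S * I * cfc (fun x : ℝ => x) S = cfc (fun x : ℝ => x) S by
      rwa [hid] at this
    rw [hI, ← cfc_mul _ _ S (hcont _) (hcont _), ← cfc_mul _ _ S (hcont _) (hcont _)]
    exact cfc_congr fun x _ => by by_cases h : x = 0 <;> simp [h]
  have hWM : (M * I)ᴴ * M = S := by
    rw [Matrix.conjTranspose_mul, ← Matrix.star_eq_conjTranspose I, hIa, mul_assoc, ← hSS, hISS]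
  have hMz : M * I * S = M := by
    have h0 : (M - M * I * S)ᴴ * (M - M * I * S) = 0 := by
      have hSI : S * S * I = S := by
        have := congrArg star hISS
        rw [star_mul, star_mul, hSa.star_eq, hIa] at this
        exact this
      have e1 : (M * I * S)ᴴ = S * (M * I)ᴴ := by
        rw [Matrix.conjTranspose_mul, ← Matrix.star_eq_conjTranspose S, hSa.star_eq]
      rw [Matrix.conjTranspose_sub, e1]
      have e2 : (M * I)ᴴ * (M * I * S) = S * I * S := by
        rw [← mul_assoc, ← mul_assoc, hWM]
      have e3 : Mᴴ * (M * I * S) = S * S := by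
        rw [← mul_assoc, ← mul_assoc, ← hSS, hSI]
      have e4 : S * (M * I)ᴴ * M = S * S := by rw [mul_assoc, hWM]
      have e5 : S * (M * I)ᴴ * (M * I * S) = S * S := by rw [mul_assoc, e2, hSIS]
      rw [sub_mul, mul_sub, mul_sub, e3, e4, e5, hSS]
      simp
    have := Matrix.conjTranspose_mul_self_eq_zero.mp h0
    exact (sub_eq_zero.mp this).symm
  refine ⟨M * I, ?_, hMz.symm, hWM⟩
  set W := M * I
  have hP : Wᴴ * W = S * I := by
    rw [← mul_assoc, hWM]
  -- As `W†W` is a projection, `‖W‖⁴ = ‖W‖²`, which forces `‖W‖ ≤ 1`.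
  have hPP : (Wᴴ * W) * (Wᴴ * W) = Wᴴ * W := by
    rw [hP, ← mul_assoc, hSIS]
  have h1 : ‖Wᴴ * W‖ = ‖W‖ * ‖W‖ := Matrix.l2_opNorm_conjTranspose_mul_self W
  have h2 : ‖(Wᴴ * W)ᴴ * (Wᴴ * W)‖ = ‖Wᴴ * W‖ * ‖Wᴴ * W‖ :=
    Matrix.l2_opNorm_conjTranspose_mul_self _
  rw [Matrix.conjTranspose_mul, Matrix.conjTranspose_conjTranspose, hPP] at h2
  rw [h1] at h2
  by_contra hlt
  push Not at hlt
  have : 1 < ‖W‖ * ‖W‖ := by nlinarith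
  nlinarith

theorem posSemidef_abs (M : Matrix ι ι ℂ) : (CFC.sqrt (Mᴴ * M)).PosSemidef :=
  Matrix.nonneg_iff_posSemidef.mp (CFC.sqrt_nonneg _)

theorem traceNorm_nonneg (M : Matrix ι ι ℂ) : 0 ≤ traceNorm M :=
  (Complex.le_def.mp (posSemidef_abs M).trace_nonneg).1

theorem norm_trace_mul_le_traceNorm (Y M : Matrix ι ι ℂ) :
    ‖(Y * M).trace‖ ≤ ‖Y‖ * traceNorm M := by
  obtain ⟨W, hW, hM, -⟩ := exists_polar M
  conv_lhs => rw [hM, ← mul_assoc]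
  refine (norm_trace_mul_le _ (posSemidef_abs M)).trans ?_
  refine mul_le_mul_of_nonneg_right ?_ (traceNorm_nonneg M)
  exact (norm_mul_le _ _).trans (mul_le_of_le_one_right (norm_nonneg _) hW)

theorem exists_trace_mul_eq_traceNorm (M : Matrix ι ι ℂ) :
    ∃ Y : Matrix ι ι ℂ, ‖Y‖ ≤ 1 ∧ ‖(Y * M).trace‖ = traceNorm M := by
  obtain ⟨W, hW, -, hM⟩ := exists_polar M
  refine ⟨Wᴴ, by rwa [Matrix.l2_opNorm_conjTranspose], ?_⟩
  rw [hM]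
  have h := Complex.le_def.mp (posSemidef_abs M).trace_nonneg
  have : (CFC.sqrt (Mᴴ * M)).trace = ((traceNorm M : ℝ) : ℂ) :=
    Complex.ext rfl (by simpa using h.2.symm)
  rw [this, Complex.norm_real, Real.norm_of_nonneg (traceNorm_nonneg M)]

theorem traceNorm_vecMulVec_le (x y : ι → ℂ) :
    traceNorm (Matrix.vecMulVec x y) ≤ √(∑ i, ‖x i‖ ^ 2) * √(∑ i, ‖y i‖ ^ 2) := by
  obtain ⟨Y, hY, h⟩ := exists_trace_mul_eq_traceNorm (Matrix.vecMulVec x y)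
  rw [← h, Matrix.mul_vecMulVec, Matrix.trace_vecMulVec, dotProduct_comm]
  refine (norm_dotProduct_mulVec_le _ _ _).trans ?_
  rw [mul_comm (√(∑ i, ‖x i‖ ^ 2))]
  exact mul_le_of_le_one_left (by positivity) hY

end TraceDuality

/-! ### Duality of norms and the upper bound for amplifications -/

section Amplification

open scoped MatrixOrder ComplexOrder

section OpNorm

variable {ι κ : Type} [Fintype ι] [DecidableEq ι] [Fintype κ] [DecidableEq κ]

theorem opNorm_nonneg (Ψ : Matrix ι ι ℂ →ₗ[ℂ] Matrix κ κ ℂ) : 0 ≤ opNorm Ψ :=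
  norm_nonneg _

theorem norm_le_opNorm_mul (Ψ : Matrix ι ι ℂ →ₗ[ℂ] Matrix κ κ ℂ) (X : Matrix ι ι ℂ) :
    ‖Ψ X‖ ≤ opNorm Ψ * ‖X‖ :=
  (LinearMap.toContinuousLinearMap Ψ).le_opNorm X

theorem opNorm_le (Ψ : Matrix ι ι ℂ →ₗ[ℂ] Matrix κ κ ℂ) {c : ℝ} (hc : 0 ≤ c)
    (h : ∀ X, ‖Ψ X‖ ≤ c * ‖X‖) : opNorm Ψ ≤ c :=
  (LinearMap.toContinuousLinearMap Ψ).opNorm_le_bound hc h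

/-- The map `X ↦ 1 ⊗ X` is a star homomorphism of C⋆-algebras, hence contractive. -/
theorem norm_one_kronecker_le (X : Matrix κ κ ℂ) : ‖(1 : Matrix ι ι ℂ) ⊗ₖ X‖ ≤ ‖X‖ := by
  let f : Matrix κ κ ℂ →⋆ₐ[ℂ] Matrix (ι × κ) (ι × κ) ℂ :=
    { toFun := fun X => (1 : Matrix ι ι ℂ) ⊗ₖ X
      map_one' := Matrix.one_kronecker_one
      map_mul' := fun X Y => by rw [← Matrix.mul_kronecker_mul, one_mul]
      map_zero' := Matrix.kronecker_zero _
      map_add' := fun X Y => Matrix.kronecker_add _ _ _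
      commutes' := fun r => by
        rw [Algebra.algebraMap_eq_smul_one, Algebra.algebraMap_eq_smul_one,
          Matrix.kronecker_smul, Matrix.one_kronecker_one]
      map_star' := fun X => by
        rw [Matrix.star_eq_conjTranspose, Matrix.star_eq_conjTranspose,
          Matrix.conjTranspose_kronecker, Matrix.conjTranspose_one] }
  exact NonUnitalStarAlgHom.norm_apply_le f X

/-- The trace pairing exchanges the operator norm of a map and the trace-norm norm of its dual. -/
theorem opNorm_eq_oneNorm (Ψ : Matrix ι ι ℂ →ₗ[ℂ] Matrix κ κ ℂ)
    (Φ : Matrix κ κ ℂ →ₗ[ℂ] Matrix ι ι ℂ)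
    (h : ∀ X Y, (Ψ X * Y).trace = (X * Φ Y).trace) : opNorm Ψ = oneNorm Φ := by
  have hle : ∀ Y, traceNorm (Φ Y) ≤ opNorm Ψ * traceNorm Y := fun Y => by
    obtain ⟨X, hX, he⟩ := exists_trace_mul_eq_traceNorm (Φ Y)
    rw [← he, ← h]
    refine (norm_trace_mul_le_traceNorm _ _).trans ?_
    refine mul_le_mul_of_nonneg_right ?_ (traceNorm_nonneg Y)
    exact (norm_le_opNorm_mul Ψ X).trans (mul_le_of_le_one_right (opNorm_nonneg Ψ) hX)
  have hub : ∀ r ∈ {r : ℝ | ∃ Y : Matrix κ κ ℂ, traceNorm Y ≤ 1 ∧ r = traceNorm (Φ Y)},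
      r ≤ opNorm Ψ := by
    rintro r ⟨Y, hY, rfl⟩
    exact (hle Y).trans (mul_le_of_le_one_right (opNorm_nonneg Ψ) hY)
  have hY0 : ∀ Y, traceNorm Y ≤ 1 → traceNorm (Φ Y) ≤ oneNorm Φ := fun Y hY =>
    le_csSup ⟨_, hub⟩ ⟨Y, hY, rfl⟩
  have h0 : traceNorm (0 : Matrix κ κ ℂ) ≤ 1 := by simp [traceNorm]
  have hc : 0 ≤ oneNorm Φ := (traceNorm_nonneg _).trans (hY0 0 h0)
  refine le_antisymm (opNorm_le Ψ hc fun X => ?_) (csSup_le ⟨_, 0, h0, rfl⟩ hub)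
  refine norm_le_of_dotProduct_mulVec_le _ (by positivity) fun x y => ?_
  set a := √(∑ i, ‖x i‖ ^ 2) with ha
  set b := √(∑ i, ‖y i‖ ^ 2) with hb
  have hxy := traceNorm_vecMulVec_le y x
  rw [← ha, ← hb] at hxy
  -- `oneNorm` only tests the trace-norm unit ball, so the rank-one matrix `y xᵀ` is scaled by `(b *
  -- a)⁻¹`; if `b * a = 0` the pairing already vanishes.
  rcases eq_or_lt_of_le (by positivity : 0 ≤ b * a) with hab | hab
  · have := norm_dotProduct_mulVec_le (Ψ X) x y
    rw [← ha, ← hb, mul_comm a, ← hab, mul_zero] at this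
    rw [mul_comm a, ← hab, mul_zero]
    exact this
  · have hs : ∀ t : ℝ, 0 ≤ t → traceNorm (Matrix.vecMulVec ((t : ℂ) • y) x) ≤ t * (b * a) := by
      intro t ht
      refine (traceNorm_vecMulVec_le _ _).trans_eq ?_
      have : √(∑ i, ‖((t : ℂ) • y) i‖ ^ 2) = t * b := by
        simp only [Pi.smul_apply, norm_smul, mul_pow, ← Finset.mul_sum]
        rw [Real.sqrt_mul (by positivity), Real.sqrt_sq (by positivity), Complex.norm_real,
          Real.norm_of_nonneg ht]
      rw [this, mul_assoc]
    have h1 := hY0 _ ((hs (b * a)⁻¹ (by positivity)).trans_eq (inv_mul_cancel₀ hab.ne'))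
    have h2 := norm_trace_mul_le_traceNorm X
      (Φ (Matrix.vecMulVec ((((b * a)⁻¹ : ℝ) : ℂ) • y) x))
    rw [← h, Matrix.mul_vecMulVec, Matrix.trace_vecMulVec, Matrix.mulVec_smul, smul_dotProduct,
      norm_smul, Complex.norm_real, Real.norm_of_nonneg (by positivity), dotProduct_comm,
      inv_mul_le_iff₀ hab] at h2
    refine h2.trans ?_
    calc b * a * (‖X‖ * _) ≤ b * a * (‖X‖ * oneNorm Φ) := by gcongr
      _ = _ := by ring

end OpNorm

theorem trace_mul_eq_sum_blocks {ι κ : Type} [Fintype ι] [Fintype κ]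
    (P Q : Matrix (ι × κ) (ι × κ) ℂ) :
    (P * Q).trace = ∑ i, ∑ j, ((Matrix.of fun c d => P (i, c) (j, d)) *
      (Matrix.of fun c d => Q (j, c) (i, d))).trace := by
  simp only [Matrix.trace, Matrix.diag, Matrix.mul_apply, Fintype.sum_prod_type, Matrix.of_apply]
  exact Finset.sum_congr rfl fun i _ => Finset.sum_comm

theorem of_ampl_apply {n k : ℕ} (m : ℕ) (φ : Mat n n →ₗ[ℂ] Mat k k)
    (X : Matrix (Fin m × Fin n) (Fin m × Fin n) ℂ) (i j : Fin m) :
    (Matrix.of fun a b => ampl m φ X (i, a) (j, b)) =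
      φ (Matrix.of fun c d => X (i, c) (j, d)) := by
  ext a b
  rw [Matrix.of_apply, ampl_apply]

theorem trace_ampl_mul {n k : ℕ} (m : ℕ) (φ : Mat n n →ₗ[ℂ] Mat k k)
    (X : Matrix (Fin m × Fin n) (Fin m × Fin n) ℂ) (Y : Matrix (Fin m × Fin k) (Fin m × Fin k) ℂ) :
    (ampl m φ X * Y).trace = (X * ampl m (dualMap φ) Y).trace := by
  rw [trace_mul_eq_sum_blocks, trace_mul_eq_sum_blocks]
  simp only [of_ampl_apply, trace_mul_dualMap]

/-- The size `k` is the output size of `φ` and so the input size of its dual, exactly the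
amplification used by the diamond norm. -/
theorem opNorm_ampl_eq_diamondNorm {n k : ℕ} (φ : Mat n n →ₗ[ℂ] Mat k k) :
    opNorm (ampl k φ) = diamondNorm (dualMap φ) :=
  opNorm_eq_oneNorm _ _ (trace_ampl_mul k φ)

theorem norm_mul_mul_le {ι₁ ι₂ ι₃ ι₄ : Type} [Fintype ι₁] [Fintype ι₂] [Fintype ι₃] [Fintype ι₄]
    [DecidableEq ι₂] [DecidableEq ι₃] [DecidableEq ι₄]
    (R : Matrix ι₁ ι₂ ℂ) (X : Matrix ι₂ ι₃ ℂ) (C : Matrix ι₃ ι₄ ℂ) {r x c : ℝ}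
    (hR : ‖R‖ ≤ r) (hX : ‖X‖ ≤ x) (hC : ‖C‖ ≤ c) : ‖R * X * C‖ ≤ r * x * c := by
  have hr := (norm_nonneg R).trans hR
  have hx := (norm_nonneg X).trans hX
  calc ‖R * X * C‖ ≤ ‖R * X‖ * ‖C‖ := Matrix.l2_opNorm_mul _ _
    _ ≤ ‖R‖ * ‖X‖ * ‖C‖ := by gcongr; exact Matrix.l2_opNorm_mul _ _
    _ ≤ r * x * c := by gcongr

/-- A generalized Choi–Kraus representation bounds all amplifications. -/
theorem opNorm_ampl_le_krausCost {n k l : ℕ} (m : ℕ) {φ : Mat n n →ₗ[ℂ] Mat k k}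
    {A : Fin l → Mat k n} {B : Fin l → Mat n k} (h : IsChoiKraus φ A B) :
    opNorm (ampl m φ) ≤ krausCost A B := by
  refine opNorm_le _ (by unfold krausCost; positivity) fun X => ?_
  -- `R` is the block row of the `1 ⊗ A_i`, and `C` the block column of the `1 ⊗ B_i`.
  let R : Matrix (Fin m × Fin k) (Fin l × (Fin m × Fin n)) ℂ :=
    Matrix.of fun p q => if p.1 = q.2.1 then A q.1 p.2 q.2.2 else 0
  let C : Matrix (Fin l × (Fin m × Fin n)) (Fin m × Fin k) ℂ :=
    Matrix.of fun q p => if p.1 = q.2.1 then B q.1 q.2.2 p.2 else 0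
  have hR : R * Rᴴ = (1 : Mat m m) ⊗ₖ (∑ i, A i * (A i)ᴴ) := by
    ext ⟨p, a⟩ ⟨q, b⟩
    simp only [R, Matrix.mul_apply, Fintype.sum_prod_type, Matrix.conjTranspose_apply,
      Matrix.of_apply, Matrix.kronecker_apply, Matrix.sum_apply, Matrix.one_apply]
    by_cases hpq : p = q <;> simp [hpq, apply_ite]
  have hC : Cᴴ * C = (1 : Mat m m) ⊗ₖ (∑ i, (B i)ᴴ * B i) := by
    ext ⟨p, a⟩ ⟨q, b⟩
    simp only [C, Matrix.mul_apply, Fintype.sum_prod_type, Matrix.conjTranspose_apply,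
      Matrix.of_apply, Matrix.kronecker_apply, Matrix.sum_apply, Matrix.one_apply]
    by_cases hpq : p = q <;> simp [hpq, apply_ite]
  have hX : ampl m φ X = R * ((1 : Mat l l) ⊗ₖ X) * C := by
    ext ⟨p, a⟩ ⟨q, b⟩
    rw [ampl_apply, h]
    simp [R, C, Matrix.mul_apply, Fintype.sum_prod_type, Matrix.sum_apply, Matrix.one_apply,
      Finset.sum_mul]
  have hRn : ‖R‖ ≤ √‖∑ i, A i * (A i)ᴴ‖ := by
    refine Real.le_sqrt_of_sq_le ?_
    have := Matrix.l2_opNorm_conjTranspose_mul_self Rᴴ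
    rw [Matrix.conjTranspose_conjTranspose, hR, Matrix.l2_opNorm_conjTranspose] at this
    rw [sq, ← this]
    exact norm_one_kronecker_le _
  have hCn : ‖C‖ ≤ √‖∑ i, (B i)ᴴ * B i‖ := by
    refine Real.le_sqrt_of_sq_le ?_
    have := Matrix.l2_opNorm_conjTranspose_mul_self C
    rw [hC] at this
    rw [sq, ← this]
    exact norm_one_kronecker_le _
  rw [hX]
  refine (norm_mul_mul_le R _ C hRn (norm_one_kronecker_le X) hCn).trans_eq ?_
  rw [krausCost, mul_right_comm]

end Amplification

/-! ### Representations of small weighted cost -/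

section WeightedRepresentation

open scoped MatrixOrder ComplexOrder

variable {n k : ℕ}

theorem apply_eq_sum_single {V : Type*} [AddCommGroup V] [Module ℂ V] (ψ : Mat n n →ₗ[ℂ] V)
    (X : Mat n n) : ψ X = ∑ i, ∑ j, X i j • ψ (Matrix.single i j 1) := by
  conv_lhs => rw [Matrix.matrix_eq_sum_single X]
  simp only [map_sum, ← map_smul, Matrix.smul_single, smul_eq_mul, mul_one]

theorem eq_sum_mul_mul_of_single {ι : Type} [Fintype ι] {ψ : Mat n n →ₗ[ℂ] Mat k k}
    {A : ι → Mat k n} {B : ι → Mat n k}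
    (h : ∀ i j a b, ∑ l, A l a i * B l j b = ψ (Matrix.single i j 1) a b) (X : Mat n n) :
    ψ X = ∑ l, A l * X * B l := by
  rw [apply_eq_sum_single ψ X]
  ext a b
  simp only [Matrix.sum_apply, Matrix.smul_apply, smul_eq_mul, ← h, Matrix.mul_apply,
    Finset.mul_sum, Finset.sum_mul]
  rw [Finset.sum_congr rfl fun i _ => Finset.sum_comm, Finset.sum_comm]
  refine Finset.sum_congr rfl fun l _ => ?_
  rw [Finset.sum_comm]
  exact Finset.sum_congr rfl fun i _ => Finset.sum_congr rfl fun j _ => by ring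

theorem exists_isChoiKraus_of_fintype {ι : Type} [Fintype ι] {φ : Mat n n →ₗ[ℂ] Mat k k}
    (A : ι → Mat k n) (B : ι → Mat n k) (h : ∀ X, φ X = ∑ l, A l * X * B l) :
    ∃ (m : ℕ) (A' : Fin m → Mat k n) (B' : Fin m → Mat n k), IsChoiKraus φ A' B' ∧
      ∑ i, A' i * (A' i)ᴴ = ∑ l, A l * (A l)ᴴ ∧ ∑ i, (B' i)ᴴ * B' i = ∑ l, (B l)ᴴ * B l := by
  let e := (Fintype.equivFin ι).symm
  exact ⟨Fintype.card ι, A ∘ e, B ∘ e,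
    fun X => (h X).trans (Equiv.sum_comp e fun l => A l * X * B l).symm,
    Equiv.sum_comp e fun l => A l * (A l)ᴴ, Equiv.sum_comp e fun l => (B l)ᴴ * B l⟩

/-- A representation of minimal Hilbert–Schmidt cost, together with a dual certificate. -/
theorem exists_nuclear_representation (ψ : Mat n n →ₗ[ℂ] Mat k k) :
    ∃ (A : Fin k × Fin n → Mat k n) (B : Fin k × Fin n → Mat n k)
      (Y : Matrix (Fin k × Fin n) (Fin k × Fin n) ℂ),
      (∀ X, ψ X = ∑ l, A l * X * B l) ∧ ‖Y‖ ≤ 1 ∧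
      ∑ l, ((A l)ᴴ * A l).trace.re ≤
        ‖∑ p, ∑ q, ψ (Matrix.of fun i j => Y (p, i) (q, j)) p q‖ ∧
      ∑ l, ((B l)ᴴ * B l).trace.re ≤
        ‖∑ p, ∑ q, ψ (Matrix.of fun i j => Y (p, i) (q, j)) p q‖ := by
  -- In this reshaping a representation of `ψ` is a factorization of `N` through the summation
  -- index; the one used is `N = (W T†) T` with `T†T = |N|`.
  let N : Matrix (Fin k × Fin n) (Fin k × Fin n) ℂ :=
    Matrix.of fun y x => ψ (Matrix.single x.2 y.2 1) x.1 y.1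
  obtain ⟨W, hW, hN, hWN⟩ := exists_polar N
  obtain ⟨T, hT⟩ := CStarAlgebra.nonneg_iff_eq_star_mul_self.mp (posSemidef_abs N).nonneg
  rw [Matrix.star_eq_conjTranspose] at hT
  rw [hT] at hN hWN
  have hY : ∑ p, ∑ q, ψ (Matrix.of fun i j => Wᴴ (p, i) (q, j)) p q = (Tᴴ * T).trace := by
    rw [← hWN]
    simp only [Matrix.trace, Matrix.diag, Matrix.mul_apply, Fintype.sum_prod_type]
    refine Finset.sum_congr rfl fun p _ => ?_
    rw [Finset.sum_comm]
    refine Finset.sum_congr rfl fun q _ => ?_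
    rw [apply_eq_sum_single ψ]
    simp only [Matrix.sum_apply, Matrix.smul_apply, smul_eq_mul, N, Matrix.of_apply]
  have hre : (Tᴴ * T).trace.re ≤ ‖(Tᴴ * T).trace‖ := Complex.re_le_norm _
  refine ⟨fun l => Matrix.of fun a i => T l (a, i), fun l => Matrix.of fun j b => (W * Tᴴ) (b, j) l,
    Wᴴ, ?_, by rwa [Matrix.l2_opNorm_conjTranspose], ?_, ?_⟩
  · refine eq_sum_mul_mul_of_single fun i j a b => ?_
    have h := congrFun (congrFun hN (b, j)) (a, i)
    rw [← mul_assoc, Matrix.mul_apply] at h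
    simp only [N, Matrix.of_apply] at h ⊢
    rw [h]
    exact Finset.sum_congr rfl fun l _ => mul_comm _ _
  · rw [hY]
    refine le_trans (le_of_eq ?_) hre
    simp only [re_trace_conjTranspose_mul_self, Fintype.sum_prod_type, Matrix.of_apply]
  · rw [hY]
    refine le_trans (le_of_eq ?_) hre
    -- By cyclicity, `Tr(W T†T W†) = Tr(W†N) = Tr |N|`, so both factors have the same cost.
    have hG : ((W * Tᴴ)ᴴᴴ * (W * Tᴴ)ᴴ).trace = (Tᴴ * T).trace := by
      rw [Matrix.trace_mul_comm, Matrix.conjTranspose_conjTranspose, Matrix.conjTranspose_mul,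
        Matrix.conjTranspose_conjTranspose, mul_assoc, Matrix.trace_mul_comm, mul_assoc, mul_assoc,
        ← hN, hWN]
    rw [← hG]
    simp only [re_trace_conjTranspose_mul_self, Fintype.sum_prod_type, Matrix.of_apply,
      Matrix.conjTranspose_apply, norm_star]
    refine Finset.sum_congr rfl fun p _ => Finset.sum_congr rfl fun i _ => Finset.sum_comm

/-- The sum is the matrix coefficient of `ampl k φ Y` at the vectorizations of `R` and `S`, whose
norms are the Hilbert–Schmidt norms. -/
theorem norm_sum_conj_ampl_le (φ : Mat n n →ₗ[ℂ] Mat k k) (R S : Mat k k)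
    (Y : Matrix (Fin k × Fin n) (Fin k × Fin n) ℂ) (hY : ‖Y‖ ≤ 1) :
    ‖∑ p, ∑ q, (R * φ (Matrix.of fun i j => Y (p, i) (q, j)) * S) p q‖ ≤
      opNorm (ampl k φ) * (√(Rᴴ * R).trace.re * √(S * Sᴴ).trace.re) := by
  let r : Fin k × Fin k → ℂ := fun x => R x.1 x.2
  let s : Fin k × Fin k → ℂ := fun x => S x.2 x.1
  have h : ∑ p, ∑ q, (R * φ (Matrix.of fun i j => Y (p, i) (q, j)) * S) p q =
      r ⬝ᵥ ampl k φ Y *ᵥ s := by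
    simp only [← of_ampl_apply, r, s, dotProduct, Matrix.mulVec, Fintype.sum_prod_type,
      Matrix.mul_apply, Matrix.of_apply, Finset.mul_sum, Finset.sum_mul]
    refine Finset.sum_congr rfl fun p _ => ?_
    conv_rhs => rw [Finset.sum_comm]
    refine Finset.sum_congr rfl fun q _ => ?_
    rw [Finset.sum_comm]
    exact Finset.sum_congr rfl fun a _ => Finset.sum_congr rfl fun b _ => mul_assoc _ _ _
  have hr : ∑ x, ‖r x‖ ^ 2 = (Rᴴ * R).trace.re := by
    rw [re_trace_conjTranspose_mul_self, Fintype.sum_prod_type]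
  have hs : ∑ x, ‖s x‖ ^ 2 = (S * Sᴴ).trace.re := by
    have := re_trace_conjTranspose_mul_self Sᴴ
    rw [Matrix.conjTranspose_conjTranspose] at this
    rw [this, Fintype.sum_prod_type]
    simp [s]
  rw [h, ← hr, ← hs]
  refine (norm_dotProduct_mulVec_le _ _ _).trans ?_
  refine mul_le_mul_of_nonneg_right ?_ (by positivity)
  exact (norm_le_opNorm_mul _ Y).trans (mul_le_of_le_one_right (opNorm_nonneg _) hY)

theorem exists_weighted_representation (φ : Mat n n →ₗ[ℂ] Mat k k) {ρ σ : Mat k k}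
    (hρ : ρ.PosDef) (hσ : σ.PosDef) :
    ∃ (A : Fin k × Fin n → Mat k n) (B : Fin k × Fin n → Mat n k),
      (∀ X, φ X = ∑ l, A l * X * B l) ∧
      (ρ * ∑ l, A l * (A l)ᴴ).trace.re + (σ * ∑ l, (B l)ᴴ * B l).trace.re ≤
        opNorm (ampl k φ) * (ρ.trace.re + σ.trace.re) := by
  obtain ⟨R, rfl⟩ := CStarAlgebra.nonneg_iff_eq_star_mul_self.mp hρ.posSemidef.nonneg
  obtain ⟨S, rfl⟩ := CStarAlgebra.nonneg_iff_eq_mul_star_self.mp hσ.posSemidef.nonneg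
  simp only [Matrix.star_eq_conjTranspose] at *
  have hR : IsUnit R.det := by
    have := (Matrix.isUnit_iff_isUnit_det _).mp hρ.isUnit
    rw [Matrix.det_mul] at this
    exact isUnit_of_mul_isUnit_right this
  have hS : IsUnit S.det := by
    have := (Matrix.isUnit_iff_isUnit_det _).mp hσ.isUnit
    rw [Matrix.det_mul] at this
    exact isUnit_of_mul_isUnit_left this
  let ψ : Mat n n →ₗ[ℂ] Mat k k := LinearMap.mulRight ℂ S ∘ₗ LinearMap.mulLeft ℂ R ∘ₗ φ
  have hψ : ∀ X, ψ X = R * φ X * S := fun X => rfl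
  obtain ⟨A, B, Y, hrep, hY, hA, hB⟩ := exists_nuclear_representation ψ
  simp only [hψ] at hA hB
  have hbound := norm_sum_conj_ampl_le φ R S Y hY
  refine ⟨fun l => R⁻¹ * A l, fun l => B l * S⁻¹, fun X => ?_, ?_⟩
  · have h1 : φ X = R⁻¹ * ψ X * S⁻¹ := by
      rw [hψ, mul_assoc R, Matrix.nonsing_inv_mul_cancel_left _ _ hR,
        Matrix.mul_nonsing_inv_cancel_right _ _ hS]
    rw [h1, hrep, Matrix.mul_sum, Matrix.sum_mul]
    exact Finset.sum_congr rfl fun l _ => by simp only [Matrix.mul_assoc]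
  · have e1 : (Rᴴ * R * ∑ l, R⁻¹ * A l * (R⁻¹ * A l)ᴴ).trace.re =
        ∑ l, ((A l)ᴴ * A l).trace.re := by
      rw [Matrix.mul_sum, Matrix.trace_sum, Complex.re_sum]
      refine Finset.sum_congr rfl fun l _ => ?_
      have hl : R * (R⁻¹ * A l) = A l := Matrix.mul_nonsing_inv_cancel_left _ _ hR
      rw [Matrix.trace_mul_comm (A l)ᴴ, mul_assoc, Matrix.trace_mul_comm, ← Matrix.mul_assoc R, hl,
        Matrix.mul_assoc, ← Matrix.conjTranspose_mul, hl]
    have e2 : (S * Sᴴ * ∑ l, (B l * S⁻¹)ᴴ * (B l * S⁻¹)).trace.re =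
        ∑ l, ((B l)ᴴ * B l).trace.re := by
      rw [Matrix.mul_sum, Matrix.trace_sum, Complex.re_sum]
      refine Finset.sum_congr rfl fun l _ => ?_
      have hl : B l * S⁻¹ * S = B l := Matrix.nonsing_inv_mul_cancel_right _ _ hS
      rw [mul_assoc, Matrix.trace_mul_comm, ← Matrix.mul_assoc Sᴴ, ← Matrix.conjTranspose_mul, hl,
        Matrix.mul_assoc, hl]
    rw [e1, e2]
    set a := (Rᴴ * R).trace.re
    set b := (S * Sᴴ).trace.re
    have ha : 0 ≤ a := (Complex.le_def.mp hρ.posSemidef.trace_nonneg).1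
    have hb : 0 ≤ b := (Complex.le_def.mp hσ.posSemidef.trace_nonneg).1
    -- Each of the two costs is at most `d √a √b`; AM–GM makes the bound on their sum linear in the
    -- weights.
    have hab : 2 * (√a * √b) ≤ a + b := by
      nlinarith [sq_nonneg (√a - √b), Real.sq_sqrt ha, Real.sq_sqrt hb]
    nlinarith [opNorm_nonneg (ampl k φ)]

end WeightedRepresentation

/-! ### Near-optimal representations by Hahn–Banach -/

section Separation

open scoped MatrixOrder ComplexOrder

variable {n k : ℕ}

/-- A functional that is nonnegative on rank one projections is given on Hermitian matrices by a
positive semidefinite matrix. -/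
theorem exists_posSemidef_of_functional {ι : Type} [Fintype ι] [DecidableEq ι]
    (f : Matrix ι ι ℂ →ₗ[ℂ] ℂ)
    (hf : ∀ x : ι → ℂ, 0 ≤ (f (Matrix.vecMulVec x (star x))).re) :
    ∃ ρ : Matrix ι ι ℂ, ρ.PosSemidef ∧
      ∀ P : Matrix ι ι ℂ, P.IsHermitian → (f P).re = (ρ * P).trace.re := by
  let τ : Matrix ι ι ℂ := Matrix.of fun i j => f (Matrix.single j i 1)
  have hτ : ∀ P, f P = (τ * P).trace := fun P => by
    conv_lhs => rw [Matrix.matrix_eq_sum_single P]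
    simp only [Matrix.trace, Matrix.diag, Matrix.mul_apply, map_sum]
    rw [Finset.sum_comm]
    refine Finset.sum_congr rfl fun i _ => Finset.sum_congr rfl fun j _ => ?_
    have : Matrix.single j i (P j i) = P j i • Matrix.single j i (1 : ℂ) := by
      rw [Matrix.smul_single, smul_eq_mul, mul_one]
    rw [this, map_smul, smul_eq_mul, mul_comm]
    rfl
  -- On Hermitian arguments, the real part of the functional only sees the Hermitian part of its
  -- density `τ`.
  let ρ : Matrix ι ι ℂ := (2⁻¹ : ℂ) • (τ + τᴴ)
  have hρh : ρ.IsHermitian := by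
    simp only [ρ, Matrix.IsHermitian, Matrix.conjTranspose_smul, Matrix.conjTranspose_add,
      Matrix.conjTranspose_conjTranspose, add_comm]
    simp
  have hρ : ∀ P : Matrix ι ι ℂ, P.IsHermitian → (ρ * P).trace = (((f P).re : ℝ) : ℂ) := by
    intro P hP
    have h1 : (τᴴ * P).trace = star (f P) := by
      rw [hτ, ← Matrix.trace_conjTranspose, Matrix.conjTranspose_mul, hP.eq, Matrix.trace_mul_comm]
    simp only [ρ, Matrix.smul_mul, Matrix.add_mul, Matrix.trace_smul, Matrix.trace_add, h1, ← hτ]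
    rw [smul_eq_mul, Complex.star_def, Complex.add_conj, Complex.ofReal_mul, Complex.ofReal_ofNat,
      inv_mul_cancel_left₀ two_ne_zero]
  refine ⟨ρ, Matrix.PosSemidef.of_dotProduct_mulVec_nonneg hρh fun x => ?_, fun P hP => by
    rw [hρ P hP, Complex.ofReal_re]⟩
  have hx : star x ⬝ᵥ ρ *ᵥ x = (ρ * Matrix.vecMulVec x (star x)).trace := by
    rw [Matrix.mul_vecMulVec, Matrix.trace_vecMulVec, dotProduct_comm]
  rw [hx, hρ _ (Matrix.posSemidef_vecMulVec_self_star x).isHermitian]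
  exact_mod_cast hf x

theorem norm_one_matrix_le {ι : Type} [Fintype ι] [DecidableEq ι] :
    ‖(1 : Matrix ι ι ℂ)‖ ≤ 1 := by
  rw [← Matrix.diagonal_one, Matrix.l2_opNorm_diagonal]
  exact (pi_norm_le_iff_of_nonneg zero_le_one).mpr fun _ => by simp

/-- The pairs of matrices dominating `(∑ A_i A_i†, ∑ B_i† B_i)` for some representation. -/
def krausSet (φ : Mat n n →ₗ[ℂ] Mat k k) : Set (Mat k k × Mat k k) :=
  {p | ∃ (m : ℕ) (A : Fin m → Mat k n) (B : Fin m → Mat n k), IsChoiKraus φ A B ∧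
    ∑ i, A i * (A i)ᴴ ≤ p.1 ∧ ∑ i, (B i)ᴴ * B i ≤ p.2}

theorem mem_krausSet_of_fintype {ι : Type} [Fintype ι] {φ : Mat n n →ₗ[ℂ] Mat k k}
    (A : ι → Mat k n) (B : ι → Mat n k) (h : ∀ X, φ X = ∑ l, A l * X * B l)
    {p : Mat k k × Mat k k} (hA : ∑ l, A l * (A l)ᴴ ≤ p.1) (hB : ∑ l, (B l)ᴴ * B l ≤ p.2) :
    p ∈ krausSet φ := by
  obtain ⟨m, A', B', h', hA', hB'⟩ := exists_isChoiKraus_of_fintype A B h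
  exact ⟨m, A', B', h', hA'.trans_le hA, hB'.trans_le hB⟩

theorem krausSet_nonempty (φ : Mat n n →ₗ[ℂ] Mat k k) : (krausSet φ).Nonempty := by
  obtain ⟨A, B, -, h, -⟩ := exists_nuclear_representation φ
  exact ⟨(_, _), mem_krausSet_of_fintype A B h le_rfl le_rfl⟩

theorem krausSet_add_mem {φ : Mat n n →ₗ[ℂ] Mat k k} {p q : Mat k k × Mat k k}
    (hp : p ∈ krausSet φ) (hq : 0 ≤ q) : p + q ∈ krausSet φ := by
  obtain ⟨m, A, B, h, hA, hB⟩ := hp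
  exact ⟨m, A, B, h, hA.trans (le_add_of_nonneg_right hq.1),
    hB.trans (le_add_of_nonneg_right hq.2)⟩

theorem real_smul_matrix_mono {ι : Type} [Fintype ι] {P Q : Matrix ι ι ℂ} (h : P ≤ Q) {s : ℝ}
    (hs : 0 ≤ s) : s • P ≤ s • Q := by
  rw [Matrix.le_iff] at h ⊢
  rw [← smul_sub]
  exact h.smul hs

/-- Two representations scaled by `√s` and `√t` and concatenated again represent `φ`, because `s + t
= 1`, and their Gram sums combine with weights `s` and `t`. -/
theorem convex_krausSet (φ : Mat n n →ₗ[ℂ] Mat k k) : Convex ℝ (krausSet φ) := by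
  rintro p ⟨m, A, B, h, hA, hB⟩ q ⟨m', A', B', h', hA', hB'⟩ s t hs ht hst
  have hsq : ∀ r : ℝ, 0 ≤ r → (√r : ℂ) * (√r : ℂ) = (r : ℂ) := fun r hr => by
    rw [← Complex.ofReal_mul, Real.mul_self_sqrt hr]
  have hsq' : ∀ r : ℝ, 0 ≤ r → ∀ P : Mat k k, (√r : ℂ) • (√r : ℂ) • P = r • P := fun r hr P => by
    rw [smul_smul, hsq r hr]
    rfl
  refine mem_krausSet_of_fintype
    (Sum.elim (fun i => (√s : ℂ) • A i) (fun i => (√t : ℂ) • A' i))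
    (Sum.elim (fun i => (√s : ℂ) • B i) (fun i => (√t : ℂ) • B' i)) (fun X => ?_) ?_ ?_
  · simp only [Fintype.sum_sum_type, Sum.elim_inl, Sum.elim_inr, Matrix.smul_mul, Matrix.mul_smul,
      hsq' s hs, hsq' t ht, ← Finset.smul_sum]
    rw [← h X, ← h' X, ← add_smul, hst, one_smul]
  · simp only [Fintype.sum_sum_type, Sum.elim_inl, Sum.elim_inr, Matrix.smul_mul, Matrix.mul_smul,
      Matrix.conjTranspose_smul, Complex.star_def, Complex.conj_ofReal,
      hsq' s hs, hsq' t ht, ← Finset.smul_sum]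
    exact add_le_add (real_smul_matrix_mono hA hs) (real_smul_matrix_mono hA' ht)
  · simp only [Fintype.sum_sum_type, Sum.elim_inl, Sum.elim_inr, Matrix.smul_mul, Matrix.mul_smul,
      Matrix.conjTranspose_smul, Complex.star_def, Complex.conj_ofReal,
      hsq' s hs, hsq' t ht, ← Finset.smul_sum]
    exact add_le_add (real_smul_matrix_mono hB hs) (real_smul_matrix_mono hB' ht)

theorem le_of_forall_add_mul_pos {u v w : ℝ} (h : ∀ ε : ℝ, 0 < ε → u ≤ v + ε * w) : u ≤ v := by
  have ht : Filter.Tendsto (fun ε : ℝ => v + ε * w) (nhdsWithin 0 (Set.Ioi 0)) (nhds v) := by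
    have : Filter.Tendsto (fun ε : ℝ => v + ε * w) (nhds 0) (nhds (v + 0 * w)) :=
      Continuous.tendsto (by fun_prop) 0
    rw [zero_mul, add_zero] at this
    exact this.mono_left nhdsWithin_le_nhds
  exact ge_of_tendsto ht (eventually_nhdsWithin_of_forall fun ε hε => h ε hε)

theorem nonneg_of_forall_le_add_mul {u v w : ℝ} (h : ∀ t : ℝ, 0 < t → u ≤ v + t * w) : 0 ≤ w := by
  have := le_of_forall_add_mul_pos (u := 0) (v := w) (w := v - u) fun ε hε => by
    have := mul_le_mul_of_nonneg_left (h ε⁻¹ (inv_pos.mpr hε)) hε.le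
    rw [mul_add, ← mul_assoc, mul_inv_cancel₀ hε.ne'] at this
    linarith
  exact this

/-- Every linear map has Choi–Kraus representations of cost arbitrarily close to the norm of its
`k`-th amplification. -/
theorem exists_isChoiKraus_norm_lt (φ : Mat n n →ₗ[ℂ] Mat k k) {c : ℝ}
    (hc : opNorm (ampl k φ) < c) :
    ∃ (m : ℕ) (A : Fin m → Mat k n) (B : Fin m → Mat n k), IsChoiKraus φ A B ∧
      ‖∑ i, A i * (A i)ᴴ‖ < c ∧ ‖∑ i, (B i)ᴴ * B i‖ < c := by
  set d := opNorm (ampl k φ) with hd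
  have hd0 : 0 ≤ d := opNorm_nonneg _
  by_cases hdisj : Disjoint (Metric.ball (0 : Mat k k × Mat k k) c) (krausSet φ)
  swap
  · obtain ⟨p, hp, m, A, B, h, hA, hB⟩ := Set.not_disjoint_iff.mp hdisj
    rw [mem_ball_zero_iff, Prod.norm_def, max_lt_iff] at hp
    have hA0 : (0 : Mat k k) ≤ ∑ i, A i * (A i)ᴴ := (Matrix.posSemidef_sum _ fun i _ =>
      Matrix.posSemidef_self_mul_conjTranspose (A i)).nonneg
    have hB0 : (0 : Mat k k) ≤ ∑ i, (B i)ᴴ * B i := (Matrix.posSemidef_sum _ fun i _ =>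
      Matrix.posSemidef_conjTranspose_mul_self (B i)).nonneg
    exact ⟨m, A, B, h, (CStarAlgebra.norm_le_norm_of_nonneg_of_le hA0 hA).trans_lt hp.1,
      (CStarAlgebra.norm_le_norm_of_nonneg_of_le hB0 hB).trans_lt hp.2⟩
  exfalso
  obtain ⟨f, u, hball, hset⟩ := RCLike.geometric_hahn_banach_open (𝕜 := ℂ)
    (convex_ball (0 : Mat k k × Mat k k) c) Metric.isOpen_ball (convex_krausSet φ) hdisj
  simp only [RCLike.re_to_complex] at hball hset
  obtain ⟨p₀, hp₀⟩ := krausSet_nonempty φ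
  have hpos : ∀ q : Mat k k × Mat k k, 0 ≤ q → 0 ≤ (f q).re := fun q hq => by
    refine nonneg_of_forall_le_add_mul (u := u) (v := (f p₀).re) fun t ht => ?_
    have hq' : 0 ≤ (t : ℂ) • q := by
      constructor
      · simpa using real_smul_matrix_mono hq.1 ht.le
      · simpa using real_smul_matrix_mono hq.2 ht.le
    have := hset _ (krausSet_add_mem hp₀ hq')
    rwa [map_add, map_smul, Complex.add_re, smul_eq_mul, Complex.re_ofReal_mul] at this
  have hrank : ∀ x : Fin k → ℂ, 0 ≤ Matrix.vecMulVec x (star x) := fun x =>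
    (Matrix.posSemidef_vecMulVec_self_star x).nonneg
  obtain ⟨ρ, hρ, hρf⟩ := exists_posSemidef_of_functional
    (f.toLinearMap ∘ₗ LinearMap.inl ℂ (Mat k k) (Mat k k)) fun x => hpos _ ⟨hrank x, le_rfl⟩
  obtain ⟨σ, hσ, hσf⟩ := exists_posSemidef_of_functional
    (f.toLinearMap ∘ₗ LinearMap.inr ℂ (Mat k k) (Mat k k)) fun x => hpos _ ⟨le_rfl, hrank x⟩
  have hf : ∀ P Q : Mat k k, P.IsHermitian → Q.IsHermitian →
      (f (P, Q)).re = (ρ * P).trace.re + (σ * Q).trace.re := fun P Q hP hQ => by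
    rw [← hρf P hP, ← hσf Q hQ, ← Complex.add_re]
    simp [← map_add]
  -- The pair `(d • 1, d • 1)` lies in the open ball because `d < c`.
  have hlt : d * (ρ.trace.re + σ.trace.re) < u := by
    have hmem : ((d : ℂ) • (1, 1) : Mat k k × Mat k k) ∈ Metric.ball 0 c := by
      rw [mem_ball_zero_iff, norm_smul, Complex.norm_real, Real.norm_of_nonneg hd0, Prod.norm_def]
      refine lt_of_le_of_lt ?_ hc
      exact mul_le_of_le_one_right hd0 (max_le norm_one_matrix_le norm_one_matrix_le)
    have := hball _ hmem
    rw [map_smul, smul_eq_mul, Complex.re_ofReal_mul, hf 1 1 Matrix.isHermitian_one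
      Matrix.isHermitian_one, mul_one, mul_one] at this
    exact this
  refine absurd hlt (not_lt.mpr ?_)
  -- `ρ` and `σ` may be singular, while the weighted representation needs positive definite weights;
  -- add `ε • 1` and let `ε → 0`.
  refine le_of_forall_add_mul_pos (w := d * (2 * (1 : Mat k k).trace.re)) fun ε hε => ?_
  have hε1 : ((ε : ℂ) • (1 : Mat k k)).PosDef := Matrix.PosDef.one.smul (by exact_mod_cast hε)
  obtain ⟨A, B, h, hcost⟩ := exists_weighted_representation φ
    (Matrix.PosDef.posSemidef_add hρ hε1) (Matrix.PosDef.posSemidef_add hσ hε1)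
  have hu := hset _ (mem_krausSet_of_fintype A B h
    (p := (∑ l, A l * (A l)ᴴ, ∑ l, (B l)ᴴ * B l)) le_rfl le_rfl)
  have hAp : (∑ l, A l * (A l)ᴴ).PosSemidef := Matrix.posSemidef_sum _ fun i _ =>
    Matrix.posSemidef_self_mul_conjTranspose (A i)
  have hBp : (∑ l, (B l)ᴴ * B l).PosSemidef := Matrix.posSemidef_sum _ fun i _ =>
    Matrix.posSemidef_conjTranspose_mul_self (B i)
  rw [hf _ _ hAp.isHermitian hBp.isHermitian] at hu
  have hA0 : 0 ≤ (∑ l, A l * (A l)ᴴ).trace.re := (Complex.le_def.mp hAp.trace_nonneg).1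
  have hB0 : 0 ≤ (∑ l, (B l)ᴴ * B l).trace.re := (Complex.le_def.mp hBp.trace_nonneg).1
  simp only [Matrix.add_mul, Matrix.smul_mul, Matrix.one_mul, Matrix.trace_add, Matrix.trace_smul,
    Complex.add_re, smul_eq_mul, Complex.re_ofReal_mul, ← hd] at hcost
  have := mul_nonneg hε.le hA0
  have := mul_nonneg hε.le hB0
  nlinarith

end Separation

/-! ### The cb norm, the Haagerup norm and `Γ` -/

section Main

variable {n k : ℕ}

theorem krausCost_lt {m : ℕ} {A : Fin m → Mat k n} {B : Fin m → Mat n k} {c : ℝ}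
    (hA : ‖∑ i, A i * (A i)ᴴ‖ < c) (hB : ‖∑ i, (B i)ᴴ * B i‖ < c) : krausCost A B < c := by
  have hc : 0 ≤ c := (norm_nonneg _).trans hA.le
  rw [← Real.mul_self_sqrt hc]
  exact mul_lt_mul'' (Real.sqrt_lt_sqrt (norm_nonneg _) hA) (Real.sqrt_lt_sqrt (norm_nonneg _) hB)
    (Real.sqrt_nonneg _) (Real.sqrt_nonneg _)

theorem opNorm_ampl_le (φ : Mat n n →ₗ[ℂ] Mat k k) (m : ℕ) :
    opNorm (ampl m φ) ≤ opNorm (ampl k φ) :=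
  le_of_forall_gt fun c hc => by
    obtain ⟨l, A, B, h, hA, hB⟩ := exists_isChoiKraus_norm_lt φ hc
    exact (opNorm_ampl_le_krausCost m h).trans_lt (krausCost_lt hA hB)

theorem bddAbove_opNorm_ampl (φ : Mat n n →ₗ[ℂ] Mat k k) :
    BddAbove (Set.range fun m : ℕ => opNorm (ampl (m + 1) φ)) :=
  ⟨opNorm (ampl k φ), by rintro _ ⟨m, rfl⟩; exact opNorm_ampl_le φ (m + 1)⟩

theorem cbNorm_eq_opNorm_ampl (φ : Mat n n →ₗ[ℂ] Mat k k) : cbNorm φ = opNorm (ampl k φ) := by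
  refine le_antisymm (ciSup_le fun m => opNorm_ampl_le φ (m + 1)) ?_
  -- The supremum omits the amplification of size `0`, so `k = 0` is separate; there the target is
  -- trivial and the norm is zero.
  rcases k with _ | k
  · refine (opNorm_le _ le_rfl fun X => ?_).trans (Real.iSup_nonneg fun m => opNorm_nonneg _)
    rw [Subsingleton.elim (ampl 0 φ X) 0, norm_zero, zero_mul]
  · exact le_ciSup (bddAbove_opNorm_ampl φ) k

theorem isGLB_krausCost (φ : Mat n n →ₗ[ℂ] Mat k k) :
    IsGLB {r : ℝ | ∃ (m : ℕ) (A : Fin m → Mat k n) (B : Fin m → Mat n k),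
      IsChoiKraus φ A B ∧ r = krausCost A B} (cbNorm φ) := by
  rw [cbNorm_eq_opNorm_ampl]
  refine ⟨?_, fun b hb => le_of_forall_gt fun c hc => ?_⟩
  · rintro _ ⟨m, A, B, h, rfl⟩
    exact opNorm_ampl_le_krausCost k h
  · obtain ⟨l, A, B, h, hA, hB⟩ := exists_isChoiKraus_norm_lt φ hc
    exact (hb ⟨l, A, B, h, rfl⟩).trans_lt (krausCost_lt hA hB)

theorem ampl_add (m : ℕ) (φ ψ : Mat n n →ₗ[ℂ] Mat k k) :
    ampl m (φ + ψ) = ampl m φ + ampl m ψ := by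
  ext1 X
  ext ⟨i, a⟩ ⟨j, b⟩
  simp [ampl_apply]

theorem ampl_smul (m : ℕ) (c : ℂ) (φ : Mat n n →ₗ[ℂ] Mat k k) :
    ampl m (c • φ) = c • ampl m φ := by
  ext1 X
  ext ⟨i, a⟩ ⟨j, b⟩
  simp [ampl_apply]

/-- For `k > 0`, `φ X` is a diagonal block of the amplification at `1 ⊗ X`. This yields definiteness
of the cb norm. -/
theorem ampl_injective (n k : ℕ) :
    Function.Injective (ampl k : (Mat n n →ₗ[ℂ] Mat k k) → _) := by
  intro φ ψ h
  rcases k with _ | k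
  · exact LinearMap.ext fun X => Subsingleton.elim _ _
  · ext1 X
    ext a b
    have h1 := congrFun (congrFun (LinearMap.congr_fun h ((1 : Mat (k + 1) (k + 1)) ⊗ₖ X)) (0, a))
      (0, b)
    simpa [ampl_kronecker] using h1

theorem isNorm_cbNorm (n k : ℕ) : IsNorm (cbNorm : (Mat n n →ₗ[ℂ] Mat k k) → ℝ) := by
  rw [show (cbNorm : (Mat n n →ₗ[ℂ] Mat k k) → ℝ) = fun φ => opNorm (ampl k φ) from
    funext cbNorm_eq_opNorm_ampl]
  let _ : Norm (Mat n n →ₗ[ℂ] Mat k k) := ⟨fun φ => opNorm (ampl k φ)⟩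
  have hzero : ∀ φ : Mat n n →ₗ[ℂ] Mat k k, opNorm (ampl k φ) = 0 ↔ φ = 0 := fun φ => by
    have h0 : ampl k (0 : Mat n n →ₗ[ℂ] Mat k k) = 0 := by
      simpa using ampl_smul k 0 (0 : Mat n n →ₗ[ℂ] Mat k k)
    rw [← (ampl_injective n k).eq_iff, h0]
    refine ⟨fun h => LinearMap.ext fun X => norm_le_zero_iff.mp ?_, fun h => ?_⟩
    · exact (norm_le_opNorm_mul _ X).trans_eq (by rw [h, zero_mul])
    · refine le_antisymm (opNorm_le _ le_rfl fun X => ?_) (opNorm_nonneg _)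
      rw [h, LinearMap.zero_apply, norm_zero, zero_mul]
  exact
    { norm_nonneg := fun φ => opNorm_nonneg _
      norm_smul := fun c φ => by
        change opNorm (ampl k (c • φ)) = ‖c‖ * opNorm (ampl k φ)
        rw [ampl_smul, opNorm, map_smul, norm_smul, opNorm]
      norm_triangle := fun φ ψ => by
        change opNorm (ampl k (φ + ψ)) ≤ opNorm (ampl k φ) + opNorm (ampl k ψ)
        rw [ampl_add, opNorm, map_add]
        exact norm_add_le _ _
      norm_eq_zero_iff := hzero }

theorem Gam_tmul (A : Mat k n) (B : Mat n k) (X : Mat n n) :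
    Gam n k (A ⊗ₜ[ℂ] B) X = A * X * B :=
  rfl

theorem Gam_eq_iff_isChoiKraus {m : ℕ} (φ : Mat n n →ₗ[ℂ] Mat k k) (A : Fin m → Mat k n)
    (B : Fin m → Mat n k) : Gam n k (∑ i, A i ⊗ₜ[ℂ] B i) = φ ↔ IsChoiKraus φ A B := by
  rw [map_sum, LinearMap.ext_iff]
  refine forall_congr' fun X => ?_
  rw [eq_comm, LinearMap.sum_apply]
  rfl

/-- Existence of representations is surjectivity, and both sides have dimension `n²k²`. -/
theorem Gam_bijective (n k : ℕ) : Function.Bijective (Gam n k) := by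
  have hsurj : Function.Surjective (Gam n k) := fun φ => by
    obtain ⟨m, A, B, h, -⟩ := krausSet_nonempty φ |>.some_mem
    exact ⟨_, (Gam_eq_iff_isChoiKraus φ A B).mpr h⟩
  have hrank : Module.finrank ℂ (Mat k n ⊗[ℂ] Mat n k) =
      Module.finrank ℂ (Mat n n →ₗ[ℂ] Mat k k) := by
    rw [Module.finrank_tensorProduct, Module.finrank_linearMap]
    simp only [Module.finrank_matrix, Fintype.card_fin, Module.finrank_self]
    ring
  exact ⟨(LinearMap.injective_iff_surjective_of_finrank_eq_finrank hrank).mpr hsurj, hsurj⟩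

/-- By injectivity of `Γ`, decompositions of `U` are exactly the representations of `Γ(U)`, so both
infima run over the same set. -/
theorem cbNorm_Gam (U : Mat k n ⊗[ℂ] Mat n k) : cbNorm (Gam n k U) = haagerupNorm U := by
  have hset : {r : ℝ | ∃ (m : ℕ) (A : Fin m → Mat k n) (B : Fin m → Mat n k),
      U = ∑ i, A i ⊗ₜ[ℂ] B i ∧ r = krausCost A B} =
      {r : ℝ | ∃ (m : ℕ) (A : Fin m → Mat k n) (B : Fin m → Mat n k),
      IsChoiKraus (Gam n k U) A B ∧ r = krausCost A B} := by
    simp only [← Gam_eq_iff_isChoiKraus, (Gam_bijective n k).1.eq_iff, eq_comm (a := U)]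
  rw [haagerupNorm, hset]
  refine ((isGLB_krausCost _).csInf_eq ?_).symm
  obtain ⟨m, A, B, h, -⟩ := krausSet_nonempty (Gam n k U) |>.some_mem
  exact ⟨_, m, A, B, h, rfl⟩

theorem isNorm_haagerupNorm (n k : ℕ) :
    IsNorm (haagerupNorm : Mat k n ⊗[ℂ] Mat n k → ℝ) := by
  rw [show (haagerupNorm : Mat k n ⊗[ℂ] Mat n k → ℝ) = fun U => cbNorm (Gam n k U) from
    funext fun U => (cbNorm_Gam U).symm]
  have h := isNorm_cbNorm n k
  let _ : Norm (Mat n n →ₗ[ℂ] Mat k k) := ⟨cbNorm⟩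
  let _ : Norm (Mat k n ⊗[ℂ] Mat n k) := ⟨fun U => cbNorm (Gam n k U)⟩
  exact
    { norm_nonneg := fun U => h.norm_nonneg _
      norm_smul := fun c U => (congrArg cbNorm (map_smul _ c U)).trans (h.norm_smul c _)
      norm_triangle := fun U V =>
        (congrArg cbNorm (map_add _ U V)).trans_le (h.norm_triangle _ _)
      norm_eq_zero_iff := fun U =>
        (h.norm_eq_zero_iff _).trans (map_eq_zero_iff _ (Gam_bijective n k).1) }

end Main

end CBHaagerup

theorem mainTheorem6 (n k : ℕ) :
    -- both spaces are normed spaces, and every linear map is completely bounded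
    (∀ φ : CBHaagerup.Mat n n →ₗ[ℂ] CBHaagerup.Mat k k,
      BddAbove (Set.range fun m : ℕ => CBHaagerup.opNorm (CBHaagerup.ampl (m + 1) φ))) ∧
    CBHaagerup.IsNorm
      (CBHaagerup.cbNorm : (CBHaagerup.Mat n n →ₗ[ℂ] CBHaagerup.Mat k k) → ℝ) ∧
    CBHaagerup.IsNorm
      (CBHaagerup.haagerupNorm : CBHaagerup.Mat k n ⊗[ℂ] CBHaagerup.Mat n k → ℝ) ∧
    -- the linear map `Γ` is an isometric isomorphism
    (∀ (A : CBHaagerup.Mat k n) (B : CBHaagerup.Mat n k) (X : CBHaagerup.Mat n n),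
      CBHaagerup.Gam n k (A ⊗ₜ[ℂ] B) X = A * X * B) ∧
    Function.Bijective (CBHaagerup.Gam n k) ∧
    (∀ U : CBHaagerup.Mat k n ⊗[ℂ] CBHaagerup.Mat n k,
      CBHaagerup.cbNorm (CBHaagerup.Gam n k U) = CBHaagerup.haagerupNorm U) ∧
    -- the cb norm through the diamond norm and through generalized Choi-Kraus representations
    (∀ φ : CBHaagerup.Mat n n →ₗ[ℂ] CBHaagerup.Mat k k,
      CBHaagerup.cbNorm φ = CBHaagerup.diamondNorm (CBHaagerup.dualMap φ) ∧
      IsGLB {r : ℝ | ∃ (m : ℕ) (A : Fin m → CBHaagerup.Mat k n) (B : Fin m → CBHaagerup.Mat n k),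
          CBHaagerup.IsChoiKraus φ A B ∧ r = CBHaagerup.krausCost A B}
        (CBHaagerup.cbNorm φ)) := by
  exact ⟨CBHaagerup.bddAbove_opNorm_ampl, CBHaagerup.isNorm_cbNorm n k,
    CBHaagerup.isNorm_haagerupNorm n k, CBHaagerup.Gam_tmul, CBHaagerup.Gam_bijective n k,
    CBHaagerup.cbNorm_Gam, fun φ => ⟨(CBHaagerup.cbNorm_eq_opNorm_ampl φ).trans
      (CBHaagerup.opNorm_ampl_eq_diamondNorm φ), CBHaagerup.isGLB_krausCost φ⟩⟩
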